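/- Let $k_1,k_2,k_3\in\mathbb Z_{\ge 0}$ and $\mathcal L=\mathbb Z[x_1^{\pm1},x_2^{\pm1},x_3^{\pm1}]$. **Cluster algebra.** A seed is a triple $(\mathbf x,B,\mathbf Z)$ with $\mathbf x\in\mathbb Q(x_1,x_2,x_3)^3$ (the labeled cluster), $B=(b_{ij})$ an integer $3\times 3$ matrix and $\mathbf Z=(Z_1,Z_2,Z_3)$ polynomials of degrees $d_1,d_2,d_3$. With $[b]_+=\max(b,0)$, the mutation $\mu_m$ (with trivial coefficients) replaces the $m$-th component $x_m$ of $\mathbf x$ by $x_m^{-1}\bigl(\prod_i x_i^{[-b_{im}]_+}\bigr)^{d_m}Z_m\bigl(\prod_i x_i^{b_{im}}\bigr)$, $Z_m(u)$ by $u^{d_m}Z_m(u^{-1})$, and $b_{ij}$ by $-b_{ij}$ if $m\in\{i,j\}$ and by $b_{ij}+d_m([b_{im}]_+b_{mj}+b_{im}[-b_{mj}]_+)$ otherwise; it leaves the other components of $\mathbf x$ and of $\mathbf Z$ unchanged. Let $\mathcal A(k_1,k_2,k_3)$ be the generalized cluster algebra with initial cluster $(x_1,x_2,x_3)$, with $Z_j=1+u$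 if $k_j=0$ and $Z_j=1+k_ju+u^2$ if $k_j\ne0$, and with $b_{ij}=m_{ij}/d_j$, where $(m_{ij})=\begin{bmatrix}0&-2&2\\2&0&-2\\-2&2&0\end{bmatrix}$. Its labeled clusters are those of the seeds obtained from the initial seed by finitely many mutations; their components are the cluster variables, and a non-labeled cluster is a permutation of a labeled cluster. (Explicitly, $\mu_1(a,b,c)=\bigl(\tfrac{b^2+k_1bc+c^2}{a},b,c\bigr)$ on labeled clusters, and similarly for $\mu_2,\mu_3$.) The position $i$ in which a cluster variable $a$ appears in labeled clusters is unique; put $k_a:=k_i$. Write $|a|$ for the value of $a$ at $x_1=x_2=x_3=1$. **CGC triples.** Put $\mathscr M=\dfrac{x_1^2+x_2^2+x_3^2+k_1x_2x_3+k_2x_1x_3+k_3x_1x_2}{x_1x_2x_3}$. A CGC matrix is a matrix $P=(p_{ij})\in SL(2,\mathcal L)$ such that $p_{12}$ is a cluster variable of $\mathcal A(k_1,k_2,k_3)$ and $\mathrm{tr}\,P=\mathscr M p_{12}-k_{p_{12}}$. For $P\in M(2,\mathcal L)$ put $t_P=\mathscr M p_{12}-\mathrm{tr}\,P$ and $S_P=\begin{bmatrix}t_P&0\\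 t_P\mathscr M&t_P\end{bmatrix}$. A CGC triple $(P,Q,R)$ associated with $(a,b,c)$ consists of CGC matrices with $Q=PR-S_Q$ whose $(1,2)$-entries $(p_{12},q_{12},r_{12})=(a,b,c)$ form a non-labeled cluster. **CGC trees.** For $f\in\mathcal L$ and $\sigma\in\mathfrak S_3$, write $(y_1,y_2,y_3)=(x_{\sigma(1)},x_{\sigma(2)},x_{\sigma(3)})$ and $(l_1,l_2,l_3)=(k_{\sigma(1)},k_{\sigma(2)},k_{\sigma(3)})$, and set $$P_\sigma(f)=\begin{bmatrix}f&y_1\\ *&\frac{-fy_2y_3+l_2y_1y_3+l_3y_1y_2+y_1^2+y_2^2+y_3^2}{y_2y_3}\end{bmatrix},\quad Q_\sigma(f)=\begin{bmatrix}\frac{fy_2+l_1y_2+y_3}{y_1}&y_2\\ *&\frac{-fy_2y_3+l_3y_1y_2+y_1^2+y_2^2}{y_1y_3}\end{bmatrix},$$ $$R_\sigma(f)=\begin{bmatrix}\frac{fy_2y_3+l_1y_2y_3+l_2y_1y_3+y_1^2+y_3^2}{y_1y_2}&y_3\\ *&\frac{-fy_2y_3+y_2^2}{y_1y_2}\end{bmatrix},$$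 where each $*$ is determined by the determinant being $1$. The tree $\mathrm{CGC}\mathbb T(k_1,k_2,k_3,\sigma,f)$ is the infinite binary tree of triples of matrices with root $(P_\rho(f),\,P_\rho(f)Q_\rho(f)-S_{R_\rho(f)},\,Q_\rho(f))$, where $\rho=\sigma\circ(2\ 3)$ (composed from right to left), in which each vertex $(P,Q,R)$ has the left child $(P,PQ-S_R,Q)$ and the right child $(Q,QR-S_P,R)$. **Theorem.** Let $(P,Q,R)$ be a CGC triple associated with $(a,b,c)$, and assume $|b|>\max(|a|,|c|)$. Then there are a unique $f\in\mathcal L$, a unique $\sigma\in\mathfrak S_3$ and a unique vertex $v$ of $\mathrm{CGC}\mathbb T(k_1,k_2,k_3,\sigma,f)$ such that $v=(P,Q,R)$; that is, there is exactly one triple $(f,\sigma,v)$, with $v$ a position in the tree, such that the triple of matrices at $v$ is $(P,Q,R)$. -/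

import Mathlib

/-! Indices `1, 2, 3` are written `0, 1, 2 : Fin 3` throughout. -/

namespace GenMarkov

noncomputable section

/-! ### Generalized seeds with trivial coefficients and their mutations -/

/-- The data of a labeled seed of rank `n` in a field `F`, over the trivial coefficient semifield
`{1}`: a cluster, an exchange matrix and a tuple of exchange polynomials. -/
structure Seed (n : ℕ) (F : Type*) where
  /-- the cluster -/
  x : Fin n → F
  /-- the exchange matrix -/
  B : Matrix (Fin n) (Fin n) ℤ
  /-- the exchange polynomials -/
  Z : Fin n → Polynomial ℕ

/-- The degree `d_j` of the `j`-th exchange polynomial. -/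
def Seed.d {n : ℕ} {F : Type*} (s : Seed n F) (j : Fin n) : ℕ := (s.Z j).natDegree

/-- Mutation in direction `m` (with trivial coefficients), where `[b]₊ = max b 0`:
`x'_m = x_m⁻¹ (∏ x_i ^ [-b_{im}]₊) ^ d_m * Z_m(∏ x_i ^ b_{im})`,
`b'_{ij} = -b_{ij}` if `i = m` or `j = m`, and
`b'_{ij} = b_{ij} + d_m ([b_{im}]₊ b_{mj} + b_{im} [-b_{mj}]₊)` otherwise,
`Z'_m(u) = u ^ d_m Z_m(u⁻¹)`; everything else is unchanged. -/
def Seed.mutate {n : ℕ} {F : Type*} [Field F] (m : Fin n) (s : Seed n F) : Seed n F where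
  x := Function.update s.x m
    ((s.x m)⁻¹ * (∏ i, s.x i ^ max (-(s.B i m)) 0) ^ s.d m
      * Polynomial.aeval (∏ i, s.x i ^ s.B i m) (s.Z m))
  B := Matrix.of fun i j =>
    if i = m ∨ j = m then -(s.B i j)
    else s.B i j + (s.d m : ℤ) * (max (s.B i m) 0 * s.B m j + s.B i m * max (-(s.B m j)) 0)
  Z := Function.update s.Z m (s.Z m).reverse

/-! ### Laurent polynomials in three variables -/

/-- The ring `ℤ[x₁^{±1}, x₂^{±1}, x₃^{±1}]`: the group ring of `ℤ³`. -/
abbrev Laurent : Type := AddMonoidAlgebra ℤ (Fin 3 → ℤ)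

/-- The field of rational functions `ℚ(x₁, x₂, x₃)`, as the field of fractions of `Laurent`. -/
abbrev RatFun : Type := FractionRing Laurent

/-- The variable `x_i`. -/
def X (i : Fin 3) : Laurent := AddMonoidAlgebra.single (Pi.single i 1) 1

/-- The inverse `x_i⁻¹` of a variable. -/
def Xinv (i : Fin 3) : Laurent := AddMonoidAlgebra.single (Pi.single i (-1)) 1

theorem X_mul_Xinv (i : Fin 3) : X i * Xinv i = 1 := by
  rw [X, Xinv, AddMonoidAlgebra.single_mul_single, ← Pi.single_add]
  simp [AddMonoidAlgebra.one_def]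

/-- Evaluation `f ↦ |f|` at `x₁ = x₂ = x₃ = 1`. -/
def evalOne : Laurent →+* ℤ :=
  (AddMonoidAlgebra.lift ℤ ℤ (Fin 3 → ℤ) (1 : Multiplicative (Fin 3 → ℤ) →* ℤ)).toRingHom

/-! ### The generalized Markov cluster algebra -/

/-- The initial seed of `𝒜(k₁, k₂, k₃)`: the exchange polynomials are `Z_j = 1 + u` (so `d_j = 1`)
if `k_j = 0` and `Z_j = 1 + k_j u + u²` (so `d_j = 2`) if `k_j ≠ 0`; the `j`-th column of the
exchange matrix is that of the Markov matrix with rows `(0, -2, 2)`, `(2, 0, -2)`, `(-2, 2, 0)`,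
divided by `d_j`. -/
def initialSeed (k : Fin 3 → ℕ) : Seed 3 RatFun where
  x := fun i => algebraMap Laurent RatFun (X i)
  B := Matrix.of fun i j =>
    (!![0, -1, 1; 1, 0, -1; -1, 1, 0] : Matrix (Fin 3) (Fin 3) ℤ) i j * (if k j = 0 then 2 else 1)
  Z := fun j =>
    if k j = 0 then 1 + Polynomial.X
    else 1 + Polynomial.C (k j) * Polynomial.X + Polynomial.X ^ 2

/-- The seeds of `𝒜(k₁, k₂, k₃)`: those obtained from the initial one by finitely many
mutations. -/
inductive IsSeed (k : Fin 3 → ℕ) : Seed 3 RatFun → Prop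
  | init : IsSeed k (initialSeed k)
  | mutate (m : Fin 3) {s : Seed 3 RatFun} : IsSeed k s → IsSeed k (s.mutate m)

/-- `a` is the `i`-th component of some labeled cluster of `𝒜(k₁, k₂, k₃)`. -/
def IsClusterVariableAt (k : Fin 3 → ℕ) (i : Fin 3) (a : Laurent) : Prop :=
  ∃ s, IsSeed k s ∧ s.x i = algebraMap Laurent RatFun a

/-- `a` is a cluster variable of `𝒜(k₁, k₂, k₃)`. -/
def IsClusterVariable (k : Fin 3 → ℕ) (a : Laurent) : Prop :=
  ∃ i, IsClusterVariableAt k i a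

/-- `(a, b, c)` is a non-labeled cluster of `𝒜(k₁, k₂, k₃)`: a permutation of a labeled one. -/
def IsNonLabeledCluster (k : Fin 3 → ℕ) (a b c : Laurent) : Prop :=
  ∃ s, IsSeed k s ∧ ∃ τ : Equiv.Perm (Fin 3),
    s.x (τ 0) = algebraMap Laurent RatFun a ∧
    s.x (τ 1) = algebraMap Laurent RatFun b ∧
    s.x (τ 2) = algebraMap Laurent RatFun c

open Classical in
/-- The parity `k_a` of a cluster variable `a`: it is `k_i`, where `i` is the position in which `a`
appears in labeled clusters (with value `0` if `a` is not a cluster variable). A cluster variable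
only ever appears in one position, so the choice made here is immaterial. -/
def parity (k : Fin 3 → ℕ) (a : Laurent) : ℤ :=
  if h : ∃ i, IsClusterVariableAt k i a then (k h.choose : ℤ) else 0

/-- The generalized Markov invariant
`ℳ = (x₁² + x₂² + x₃² + k₁ x₂ x₃ + k₂ x₁ x₃ + k₃ x₁ x₂) / (x₁ x₂ x₃)`. -/
def markovInvariant (k : Fin 3 → ℕ) : Laurent :=
  (X 0 ^ 2 + X 1 ^ 2 + X 2 ^ 2 + (k 0 : Laurent) * X 1 * X 2 + (k 1 : Laurent) * X 0 * X 2
    + (k 2 : Laurent) * X 0 * X 1) * (Xinv 0 * Xinv 1 * Xinv 2)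

/-! ### Cluster generalized Cohn matrices and triples -/

/-- `2 × 2` matrices over the Laurent polynomial ring. -/
abbrev Mat : Type := Matrix (Fin 2) (Fin 2) Laurent

/-- `P` is a `(k₁, k₂, k₃)`-cluster generalized Cohn matrix. -/
structure IsCGCMatrix (k : Fin 3 → ℕ) (P : Mat) : Prop where
  det_eq : P.det = 1
  isClusterVariable : IsClusterVariable k (P 0 1)
  trace_eq : P.trace = markovInvariant k * P 0 1 - (parity k (P 0 1) : Laurent)

/-- The matrix `S_P`, with rows `(t, 0)` and `(t ℳ, t)`, where `t = ℳ p₁₂ - tr P`. -/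
def S (k : Fin 3 → ℕ) (P : Mat) : Mat :=
  !![markovInvariant k * P 0 1 - P.trace, 0;
    (markovInvariant k * P 0 1 - P.trace) * markovInvariant k, markovInvariant k * P 0 1 - P.trace]

/-- `(P, Q, R)` is a `(k₁, k₂, k₃)`-cluster generalized Cohn triple. -/
structure IsCGCTriple (k : Fin 3 → ℕ) (P Q R : Mat) : Prop where
  left : IsCGCMatrix k P
  middle : IsCGCMatrix k Q
  right : IsCGCMatrix k R
  relation : Q = P * R - S k Q
  isCluster : IsNonLabeledCluster k (P 0 1) (Q 0 1) (R 0 1)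

/-- `(P, Q, R)` is a cluster generalized Cohn triple associated with `(a, b, c)`. -/
structure IsCGCTripleAssociated (k : Fin 3 → ℕ) (P Q R : Mat) (a b c : Laurent) : Prop where
  isTriple : IsCGCTriple k P Q R
  left_eq : P 0 1 = a
  middle_eq : Q 0 1 = b
  right_eq : R 0 1 = c

/-! ### The cluster generalized Cohn trees -/

/-- The matrix of determinant `1` with first row `(p, x_i)` and `(2,2)`-entry `q`: its
`(2,1)`-entry is `(p q - 1) / x_i`. -/
def unimod (i : Fin 3) (p q : Laurent) : Mat := !![p, X i; (p * q - 1) * Xinv i, q]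

/-- `P_σ(f)`. -/
def Pmat (k : Fin 3 → ℕ) (σ : Equiv.Perm (Fin 3)) (f : Laurent) : Mat :=
  unimod (σ 0) f
    ((-f * X (σ 1) * X (σ 2) + (k (σ 1) : Laurent) * X (σ 0) * X (σ 2)
      + (k (σ 2) : Laurent) * X (σ 0) * X (σ 1) + X (σ 0) ^ 2 + X (σ 1) ^ 2 + X (σ 2) ^ 2)
      * (Xinv (σ 1) * Xinv (σ 2)))

/-- `Q_σ(f)`. -/
def Qmat (k : Fin 3 → ℕ) (σ : Equiv.Perm (Fin 3)) (f : Laurent) : Mat :=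
  unimod (σ 1)
    ((f * X (σ 1) + (k (σ 0) : Laurent) * X (σ 1) + X (σ 2)) * Xinv (σ 0))
    ((-f * X (σ 1) * X (σ 2) + (k (σ 2) : Laurent) * X (σ 0) * X (σ 1)
      + X (σ 0) ^ 2 + X (σ 1) ^ 2) * (Xinv (σ 0) * Xinv (σ 2)))

/-- `R_σ(f)`. -/
def Rmat (k : Fin 3 → ℕ) (σ : Equiv.Perm (Fin 3)) (f : Laurent) : Mat :=
  unimod (σ 2)
    ((f * X (σ 1) * X (σ 2) + (k (σ 0) : Laurent) * X (σ 1) * X (σ 2)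
      + (k (σ 1) : Laurent) * X (σ 0) * X (σ 2) + X (σ 0) ^ 2 + X (σ 2) ^ 2)
      * (Xinv (σ 0) * Xinv (σ 1)))
    ((-f * X (σ 1) * X (σ 2) + X (σ 1) ^ 2) * (Xinv (σ 0) * Xinv (σ 1)))

/-- The root of the tree: with `ρ = σ ∘ (2 3)` it is
`(P_ρ(f), P_ρ(f) Q_ρ(f) - S_{R_ρ(f)}, Q_ρ(f))`. -/
def cgcRoot (k : Fin 3 → ℕ) (σ : Equiv.Perm (Fin 3)) (f : Laurent) : Mat × Mat × Mat :=
  let ρ := σ * Equiv.swap 1 2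
  (Pmat k ρ f, Pmat k ρ f * Qmat k ρ f - S k (Rmat k ρ f), Qmat k ρ f)

/-- The left child `(P, PQ - S_R, Q)` of `(P, Q, R)`. -/
def leftChild (k : Fin 3 → ℕ) (T : Mat × Mat × Mat) : Mat × Mat × Mat :=
  (T.1, T.1 * T.2.1 - S k T.2.2, T.2.1)

/-- The right child `(Q, QR - S_P, R)` of `(P, Q, R)`. -/
def rightChild (k : Fin 3 → ℕ) (T : Mat × Mat × Mat) : Mat × Mat × Mat :=
  (T.2.1, T.2.1 * T.2.2 - S k T.1, T.2.2)

/-- The cluster generalized Cohn tree `CGCT(k₁, k₂, k₃, σ, f)`, as the infinite binary tree whose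
vertices are the words in `Bool`, each carrying a triple of matrices. The empty word is the root;
the left child of the vertex `w` is `false :: w`, and the right child is `true :: w`. -/
def cgcTree (k : Fin 3 → ℕ) (σ : Equiv.Perm (Fin 3)) (f : Laurent) : List Bool → Mat × Mat × Mat
  | [] => cgcRoot k σ f
  | false :: w => leftChild k (cgcTree k σ f w)
  | true :: w => rightChild k (cgcTree k σ f w)

end

end GenMarkov

namespace GenMarkov

/-! ### Vieta jumps on labeled clusters of Laurent polynomials -/

/-! Mutation acts on clusters by Vieta jumps: `ℳ` keeps its value on every cluster, so the new
variable is the other root of a quadratic equation. Matrix triples follow the same dynamics. If `Q =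
P R - S_Q`, Cayley–Hamilton for `P` or `R` shows that passing to a child applies a Vieta jump at an
outer position and puts the new variable in the middle. Since `P` and `R` are invertible, both kinds
of step can be undone: every labeled triple is the left child of one labeled triple and the right
child of another, by a jump at its middle position.

Existence: at `x₁ = x₂ = x₃ = 1`, the last jump of a nonempty reduced sequence produces the strictly
largest variable (`Red.evalOne_lt`). The hypothesis on `|b|` thus says that the cluster is not
initial and that the last jump was in the middle position. Undoing the jumps one by one, with the
kind of child dictated by the preceding direction, leads to a cluster one jump away from the initial
one. A triple over that cluster is determined by the `(1,1)`-entry of its left matrix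
(`IsLabeledTriple.ext_of_entry`), so it is a root, with that entry as `f`.

Uniqueness: comparing the two outer entries at `1` tells a root (equality) from a left child and a
right child, and the parent is recovered by cancelling an invertible matrix. At the root, `σ` and
`f` are read off the entries.

The trace condition involves `k_a`, so one also needs that a cluster variable occurs in one position
only. This is seen from the parity of its order of vanishing as one variable tends to `0`. -/

/-- The generalized Markov equation with value `M` of the invariant. -/
def IsMarkov {A : Type*} [CommRing A] (M : A) (k : Fin 3 → ℕ) (x : Fin 3 → A) : Prop :=
  ∀ m, x m ^ 2 + x (m + 1) ^ 2 + x (m + 2) ^ 2 + k m * x (m + 1) * x (m + 2)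
    + k (m + 1) * x m * x (m + 2) + k (m + 2) * x m * x (m + 1) = M * x m * x (m + 1) * x (m + 2)

/-- The equation is symmetric under cyclic rotation of the indices; having all three rotations in
`IsMarkov` avoids case splits on the direction of a jump. -/
theorem isMarkov_of_zero {A : Type*} [CommRing A] {M : A} {k : Fin 3 → ℕ} {x : Fin 3 → A}
    (h : x 0 ^ 2 + x 1 ^ 2 + x 2 ^ 2 + k 0 * x 1 * x 2 + k 1 * x 0 * x 2 + k 2 * x 0 * x 1
      = M * x 0 * x 1 * x 2) : IsMarkov M k x := by
  intro m
  fin_cases m <;> simp <;> linear_combination h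

/-- The Vieta jump of `x` in direction `m`. -/
noncomputable def vieta (k : Fin 3 → ℕ) (m : Fin 3) (x : Fin 3 → Laurent) : Fin 3 → Laurent :=
  Function.update x m (markovInvariant k * x (m + 1) * x (m + 2) - k (m + 1) * x (m + 2)
    - k (m + 2) * x (m + 1) - x m)

theorem fin3_add_one_ne (m : Fin 3) : m + 1 ≠ m := by revert m; decide

theorem fin3_add_two_ne (m : Fin 3) : m + 2 ≠ m := by revert m; decide

theorem fin3_cases (m i : Fin 3) : i = m ∨ i = m + 1 ∨ i = m + 2 := by
  revert m i; decide

theorem vieta_self (k : Fin 3 → ℕ) (m : Fin 3) (x : Fin 3 → Laurent) :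
    vieta k m x m = markovInvariant k * x (m + 1) * x (m + 2) - k (m + 1) * x (m + 2)
      - k (m + 2) * x (m + 1) - x m := by
  simp [vieta]

theorem vieta_of_ne (k : Fin 3 → ℕ) {m i : Fin 3} (h : i ≠ m) (x : Fin 3 → Laurent) :
    vieta k m x i = x i := by
  simp [vieta, h]

theorem vieta_vieta (k : Fin 3 → ℕ) (m : Fin 3) (x : Fin 3 → Laurent) :
    vieta k m (vieta k m x) = x := by
  funext i
  by_cases h : i = m
  · subst h
    rw [vieta_self, vieta_of_ne k (fin3_add_one_ne i), vieta_of_ne k (fin3_add_two_ne i),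
      vieta_self]
    ring
  · rw [vieta_of_ne k h, vieta_of_ne k h]

/-- The product of the two roots of the Markov quadratic in `x m`: this identifies the Vieta jump
with the exchange relation, and it is the form that shows positivity. -/
theorem IsMarkov.mul_vieta {k : Fin 3 → ℕ} {x : Fin 3 → Laurent}
    (h : IsMarkov (markovInvariant k) k x) (m : Fin 3) :
    x m * vieta k m x m = x (m + 1) ^ 2 + k m * x (m + 1) * x (m + 2) + x (m + 2) ^ 2 := by
  rw [vieta_self]
  linear_combination -(h m)

theorem IsMarkov.vieta {k : Fin 3 → ℕ} {x : Fin 3 → Laurent}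
    (h : IsMarkov (markovInvariant k) k x) (m : Fin 3) :
    IsMarkov (markovInvariant k) k (vieta k m x) := by
  apply isMarkov_of_zero
  have h0 := h 0
  fin_cases m <;> simp [GenMarkov.vieta] at h0 ⊢ <;> linear_combination h0

theorem isMarkov_X (k : Fin 3 → ℕ) : IsMarkov (markovInvariant k) k X := by
  apply isMarkov_of_zero
  have h0 := X_mul_Xinv 0
  have h1 := X_mul_Xinv 1
  have h2 := X_mul_Xinv 2
  have h : X 0 * X 1 * X 2 * (Xinv 0 * Xinv 1 * Xinv 2) = 1 := by
    linear_combination X 1 * X 2 * Xinv 1 * Xinv 2 * h0 + X 2 * Xinv 2 * h1 + h2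
  rw [markovInvariant]
  linear_combination -(X 0 ^ 2 + X 1 ^ 2 + X 2 ^ 2 + (k 0 : Laurent) * X 1 * X 2
    + (k 1 : Laurent) * X 0 * X 2 + (k 2 : Laurent) * X 0 * X 1) * h

/-- The labeled clusters reached from the initial one by Vieta jumps. -/
inductive Reach (k : Fin 3 → ℕ) : (Fin 3 → Laurent) → Prop
  | init : Reach k X
  | step (m : Fin 3) {x : Fin 3 → Laurent} : Reach k x → Reach k (vieta k m x)

/-- `Red k m x`: the labeled cluster `x` is reached from the initial one by a nonempty reduced
sequence of Vieta jumps, the last of which is in direction `m`. -/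
inductive Red (k : Fin 3 → ℕ) : Fin 3 → (Fin 3 → Laurent) → Prop
  | init (m : Fin 3) : Red k m (vieta k m X)
  | step {m : Fin 3} (j : Fin 3) {x : Fin 3 → Laurent} : j ≠ m → Red k m x → Red k j (vieta k j x)

theorem Reach.isMarkov {k : Fin 3 → ℕ} {x : Fin 3 → Laurent} (h : Reach k x) :
    IsMarkov (markovInvariant k) k x := by
  induction h with
  | init => exact isMarkov_X k
  | step m _ ih => exact ih.vieta m

/-- Vieta jumps are involutions, so repeated directions cancel. -/
theorem Reach.eq_or_red {k : Fin 3 → ℕ} {x : Fin 3 → Laurent} (h : Reach k x) :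
    x = X ∨ ∃ m, Red k m x := by
  induction h with
  | init => exact Or.inl rfl
  | step m _ ih =>
    rcases ih with rfl | ⟨j, hj⟩
    · exact Or.inr ⟨m, .init m⟩
    · by_cases hm : m = j
      · subst hm
        cases hj with
        | init => exact Or.inl (vieta_vieta ..)
        | step _ hne hr => rw [vieta_vieta]; exact Or.inr ⟨_, hr⟩
      · exact Or.inr ⟨m, .step m hm hj⟩

theorem Red.reach {k : Fin 3 → ℕ} {m : Fin 3} {x : Fin 3 → Laurent} (h : Red k m x) :
    Reach k x := by
  induction h with
  | init m => exact .step m .init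
  | step j _ _ ih => exact .step j ih

theorem evalOne_X (i : Fin 3) : evalOne (X i) = 1 := by
  simp [evalOne, X]

theorem Reach.evalOne_pos {k : Fin 3 → ℕ} {x : Fin 3 → Laurent} (h : Reach k x) (i : Fin 3) :
    0 < evalOne (x i) := by
  induction h generalizing i with
  | init => simp [evalOne_X]
  | @step m x hx ih =>
    by_cases hi : i = m
    · subst hi
      have h := congrArg evalOne (hx.isMarkov.mul_vieta i)
      simp only [map_mul, map_add, map_pow, map_natCast] at h
      have h1 := ih (i + 1)
      have h2 := ih (i + 2)
      refine pos_of_mul_pos_right ?_ (ih i).le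
      rw [h]
      positivity
    · rw [vieta_of_ne k hi]; exact ih i

theorem Reach.ne_zero {k : Fin 3 → ℕ} {x : Fin 3 → Laurent} (h : Reach k x) (i : Fin 3) :
    x i ≠ 0 := by
  intro h0
  have := h.evalOne_pos i
  simp [h0] at this

/-- By induction `x m` is the strict maximum before the jump at `j ≠ m`. The product of the old and
new values at `j` exceeds the square of `x m`, while the old value is below `x m`; so the new value
is above it. -/
theorem Red.evalOne_lt {k : Fin 3 → ℕ} {m : Fin 3} {x : Fin 3 → Laurent} (h : Red k m x)
    {i : Fin 3} (hi : i ≠ m) : evalOne (x i) < evalOne (x m) := by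
  induction h generalizing i with
  | init m =>
    have h := congrArg evalOne ((isMarkov_X k).mul_vieta m)
    simp only [map_mul, map_add, map_pow, map_natCast, evalOne_X] at h
    rw [vieta_of_ne k hi, evalOne_X]
    have : (0 : ℤ) ≤ k m := by positivity
    linarith
  | @step m j x hj hr ih =>
    have h := congrArg evalOne (hr.reach.isMarkov.mul_vieta j)
    simp only [map_mul, map_add, map_pow, map_natCast] at h
    have hp := fun i => hr.reach.evalOne_pos i
    have key : evalOne (x m) < evalOne (vieta k j x j) := by
      have hsq : evalOne (x m) ^ 2 < evalOne (x j) * evalOne (vieta k j x j) := by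
        rw [h]
        have h1 := hp (j + 1)
        have h2 := hp (j + 2)
        have : 0 ≤ k j * evalOne (x (j + 1)) * evalOne (x (j + 2)) := by positivity
        rcases fin3_cases j m with rfl | rfl | rfl
        · exact absurd rfl hj
        · nlinarith
        · nlinarith
      by_contra hle
      push Not at hle
      have hjm := ih hj
      have := mul_le_mul hjm.le hle
        (hr.reach.step j |>.evalOne_pos j).le (hp m).le
      nlinarith
    rw [vieta_of_ne k hi]
    by_cases him : i = m
    · subst him; exact key
    · exact (ih him).trans key

theorem Red.one_le_evalOne {k : Fin 3 → ℕ} {m : Fin 3} {x : Fin 3 → Laurent} (h : Red k m x)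
    (i : Fin 3) : 1 ≤ evalOne (x i) := h.reach.evalOne_pos i

/-! ### Seeds -/

theorem initialSeed_d (k : Fin 3 → ℕ) (m : Fin 3) :
    ((initialSeed k).Z m).natDegree = if k m = 0 then 1 else 2 := by
  simp only [initialSeed]
  split_ifs with h
  · compute_degree!
  · compute_degree!

/-- The exchange polynomials are palindromic, so mutation never changes them. -/
theorem initialSeed_reverse (k : Fin 3 → ℕ) (m : Fin 3) :
    ((initialSeed k).Z m).reverse = (initialSeed k).Z m := by
  have hd := initialSeed_d k m
  ext n
  rw [Polynomial.coeff_reverse, hd, ← Polynomial.revAtFun_eq]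
  simp only [initialSeed]
  split_ifs with h
  · rcases n with _ | _ | n <;> simp [Polynomial.revAtFun, Polynomial.coeff_one, Polynomial.coeff_X]
  · rcases n with _ | _ | _ | n <;>
      simp [Polynomial.revAtFun, Polynomial.coeff_one, Polynomial.coeff_X, Polynomial.coeff_X_pow]

/-- As for the Markov quiver, every mutation only changes the sign of the exchange matrix, so a seed
carries no data beyond its cluster and a sign. -/
theorem mutate_B (k : Fin 3 → ℕ) (m : Fin 3) (s : Seed 3 RatFun) (ε : ℤ) (hε : ε = 1 ∨ ε = -1)
    (hB : s.B = ε • (initialSeed k).B) (hZ : s.Z = (initialSeed k).Z) :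
    (s.mutate m).B = (-ε) • (initialSeed k).B := by
  ext i j
  simp only [Seed.mutate, Seed.d, hB, hZ, initialSeed_d, Matrix.of_apply, Matrix.smul_apply]
  rcases hε with rfl | rfl <;> fin_cases m <;> fin_cases i <;> fin_cases j <;>
    simp [initialSeed] <;> split_ifs <;> norm_num

/-- The sign `ε` swaps `u` with `u⁻¹`, which is harmless for palindromic polynomials. If `k m = 0`,
then degree `1` with exponents `±2` gives the same formula as degree `2` with exponents `±1`. -/
theorem mutate_x (k : Fin 3 → ℕ) (m : Fin 3) (s : Seed 3 RatFun) (ε : ℤ) (hε : ε = 1 ∨ ε = -1)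
    (hB : s.B = ε • (initialSeed k).B) (hZ : s.Z = (initialSeed k).Z) (h0 : ∀ i, s.x i ≠ 0) :
    s.x m * (s.mutate m).x m
      = s.x (m + 1) ^ 2 + k m * s.x (m + 1) * s.x (m + 2) + s.x (m + 2) ^ 2 := by
  have e0 := h0 0
  have e1 := h0 1
  have e2 := h0 2
  by_cases hk : k m = 0
  all_goals
    simp only [Seed.mutate, Seed.d, hB, hZ, initialSeed_d, Function.update_self, hk, if_true,
      if_false]
    rcases hε with rfl | rfl <;> fin_cases m <;> simp at hk <;>
      simp [initialSeed, Fin.prod_univ_three, hk] <;> field_simp <;> ring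

theorem IsSeed.exists_reach {k : Fin 3 → ℕ} {s : Seed 3 RatFun} (h : IsSeed k s) :
    ∃ x, Reach k x ∧ (∀ i, s.x i = algebraMap Laurent RatFun (x i)) ∧ s.Z = (initialSeed k).Z ∧
      ∃ ε : ℤ, (ε = 1 ∨ ε = -1) ∧ s.B = ε • (initialSeed k).B := by
  induction h with
  | init => exact ⟨X, .init, fun i => rfl, rfl, 1, Or.inl rfl, by simp⟩
  | @mutate m s hs ih =>
    obtain ⟨x, hx, hsx, hZ, ε, hε, hB⟩ := ih
    have hinj : Function.Injective (algebraMap Laurent RatFun) := IsFractionRing.injective _ _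
    have h0 : ∀ i, s.x i ≠ 0 := fun i => by
      rw [hsx, Ne, map_eq_zero_iff _ hinj]; exact hx.ne_zero i
    refine ⟨vieta k m x, hx.step m, fun i => ?_, ?_, -ε, ?_, mutate_B k m s ε hε hB hZ⟩
    · by_cases hi : i = m
      · subst hi
        apply mul_left_cancel₀ (h0 i)
        rw [mutate_x k i s ε hε hB hZ h0]
        have := congrArg (algebraMap Laurent RatFun) (hx.isMarkov.mul_vieta i)
        simp only [map_mul, map_add, map_pow, map_natCast, ← hsx] at this
        exact this.symm
      · rw [vieta_of_ne k hi, ← hsx]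
        simp [Seed.mutate, hi]
    · funext i
      by_cases hi : i = m
      · subst hi
        simp only [Seed.mutate, Function.update_self, hZ, initialSeed_reverse]
      · simp [Seed.mutate, hi, hZ]
    · rcases hε with rfl | rfl <;> simp

/-! ### A cluster variable appears in only one position -/

/-- Evaluation at `x_j = t` and `x_i = 1` for `i ≠ j`. -/
noncomputable def evalAt (j : Fin 3) (t : ℚˣ) : Laurent →+* ℚ :=
  (AddMonoidAlgebra.lift ℤ ℚ (Fin 3 → ℤ)
    { toFun := fun n => ((t ^ (n.toAdd j) : ℚˣ) : ℚ)
      map_one' := by simp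
      map_mul' := fun a b => by simp [zpow_add] }).toRingHom

theorem evalAt_X_self (j : Fin 3) (t : ℚˣ) : evalAt j t (X j) = t := by
  simp [evalAt, X]

theorem evalAt_X_of_ne {i j : Fin 3} (h : i ≠ j) (t : ℚˣ) : evalAt j t (X i) = 1 := by
  simp [evalAt, X, h.symm]

/-- `f` has the exact order of growth `t ^ n` when `x_j = t` tends to `0` from above and the other
variables are `1`. -/
def HasOrder (j : Fin 3) (n : ℤ) (f : Laurent) : Prop :=
  ∃ C : ℚ, 0 < C ∧ ∀ t : ℚˣ, (0 : ℚ) < t → (t : ℚ) ≤ 1 →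
    (t : ℚ) ^ n ≤ C * evalAt j t f ∧ evalAt j t f ≤ C * (t : ℚ) ^ n

/-- If `n < m`, the bounds give `1 ≤ C D t`, which fails at `t = 1 / (C D + 1)`. Applied both ways,
this makes the order unique. -/
theorem HasOrder.le {j : Fin 3} {n m : ℤ} {f : Laurent} (hn : HasOrder j n f)
    (hm : HasOrder j m f) : m ≤ n := by
  obtain ⟨C, hC, h⟩ := hn
  obtain ⟨D, hD, h'⟩ := hm
  by_contra hlt
  push Not at hlt
  have hpos : 0 < C * D + 1 := by positivity
  let t : ℚˣ := (Units.mk0 (C * D + 1) hpos.ne')⁻¹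
  have ht : (t : ℚ) = (C * D + 1)⁻¹ := by simp [t]
  have ht0 : (0 : ℚ) < t := by rw [ht]; positivity
  have ht1 : (t : ℚ) ≤ 1 := by
    rw [ht]; apply inv_le_one_of_one_le₀; nlinarith [mul_pos hC hD]
  have h1 : (t : ℚ) ^ n ≤ C * D * (t : ℚ) ^ m :=
    (h t ht0 ht1).1.trans (by
      rw [mul_assoc]; exact mul_le_mul_of_nonneg_left (h' t ht0 ht1).2 hC.le)
  have h2 : (t : ℚ) ^ m ≤ (t : ℚ) ^ (n + 1) := zpow_le_zpow_right_of_le_one₀ ht0 ht1 (by omega)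
  have h3 : (t : ℚ) ^ n ≤ C * D * (t : ℚ) ^ (n + 1) :=
    h1.trans (mul_le_mul_of_nonneg_left h2 (by positivity))
  rw [zpow_add_one₀ ht0.ne'] at h3
  have h4 : (0 : ℚ) < (t : ℚ) ^ n := by positivity
  have h5 : (C * D + 1) * (t : ℚ) = 1 := by rw [ht]; exact mul_inv_cancel₀ hpos.ne'
  nlinarith [mul_pos h4 ht0]

/-- All terms are positive at positive `t`, so nothing cancels and the right-hand side has order `2
* min q r`. -/
theorem HasOrder.mutation {j : Fin 3} {p q r : ℤ} {a a' b c : Laurent} {k : ℕ}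
    (ha : HasOrder j p a) (hb : HasOrder j q b) (hc : HasOrder j r c)
    (h : a * a' = b ^ 2 + k * b * c + c ^ 2) : HasOrder j (2 * min q r - p) a' := by
  wlog hqr : q ≤ r generalizing b c q r
  · rw [min_comm]
    exact this hc hb (by linear_combination h) (by omega)
  rw [min_eq_left hqr]
  obtain ⟨A, hA, ha⟩ := ha
  obtain ⟨B, hB, hb⟩ := hb
  obtain ⟨C, hC, hc⟩ := hc
  -- The first summand serves the lower bound and the second the upper bound; `HasOrder` asks for a
  -- single constant.
  refine ⟨A * B ^ 2 + A * (B ^ 2 + k * B * C + C ^ 2), by positivity, fun t ht0 ht1 => ?_⟩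
  obtain ⟨ha1, ha2⟩ := ha t ht0 ht1
  obtain ⟨hb1, hb2⟩ := hb t ht0 ht1
  obtain ⟨hc1, hc2⟩ := hc t ht0 ht1
  have h' := congrArg (evalAt j t) h
  simp only [map_mul, map_add, map_pow, map_natCast] at h'
  have hrq : (t : ℚ) ^ r ≤ (t : ℚ) ^ q := zpow_le_zpow_right_of_le_one₀ ht0 ht1 hqr
  have hc2' : evalAt j t c ≤ C * (t : ℚ) ^ q :=
    hc2.trans (mul_le_mul_of_nonneg_left hrq hC.le)
  have hexp : (t : ℚ) ^ (2 * q - p) * (t : ℚ) ^ p = ((t : ℚ) ^ q) ^ 2 := by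
    rw [← zpow_add₀ ht0.ne', ← zpow_natCast, ← zpow_mul]; congr 1; push_cast; ring
  have hu : (0 : ℚ) < (t : ℚ) ^ p := by positivity
  have hv : (0 : ℚ) < (t : ℚ) ^ q := by positivity
  have hw : (0 : ℚ) < (t : ℚ) ^ r := by positivity
  have hz : (0 : ℚ) < (t : ℚ) ^ (2 * q - p) := by positivity
  generalize (t : ℚ) ^ (2 * q - p) = z at *
  generalize (t : ℚ) ^ p = u at *
  generalize (t : ℚ) ^ q = v at *
  generalize (t : ℚ) ^ r = w at *
  generalize evalAt j t a = a at *
  generalize evalAt j t a' = a' at *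
  generalize evalAt j t b = b at *
  generalize evalAt j t c = c at *
  have ha0 : 0 < a := pos_of_mul_pos_right (hu.trans_le ha1) hA.le
  have hb0 : 0 < b := pos_of_mul_pos_right (hv.trans_le hb1) hB.le
  have hc0 : 0 < c := pos_of_mul_pos_right (hw.trans_le hc1) hC.le
  have ha'0 : 0 < a' := by
    refine pos_of_mul_pos_right ?_ ha0.le
    rw [h']; positivity
  have hk : (0 : ℚ) ≤ k := by positivity
  constructor
  · have e1 : z * u ≤ A * B ^ 2 * a' * u := by
      have s1 : v ^ 2 ≤ (B * b) ^ 2 := by gcongr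
      have s2 : b ^ 2 ≤ a * a' := by
        rw [h']; have : 0 ≤ k * b * c := by positivity
        nlinarith [sq_nonneg c]
      have s3 : B ^ 2 * (a * a') ≤ B ^ 2 * ((A * u) * a') := by gcongr
      have s4 : B ^ 2 * b ^ 2 ≤ B ^ 2 * (a * a') := by gcongr
      rw [hexp]
      nlinarith
    have e2 : z ≤ A * B ^ 2 * a' := le_of_mul_le_mul_right e1 hu
    have : 0 ≤ A * (B ^ 2 + k * B * C + C ^ 2) * a' := by positivity
    linarith [add_mul (A * B ^ 2) (A * (B ^ 2 + k * B * C + C ^ 2)) a']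
  · have e1 : a' * u ≤ A * (B ^ 2 + k * B * C + C ^ 2) * z * u := by
      have s1 : a' * u ≤ a' * (A * a) := by gcongr
      have s2 : b ^ 2 + k * b * c + c ^ 2
          ≤ (B * v) ^ 2 + k * (B * v) * (C * v) + (C * v) ^ 2 := by gcongr
      have s3 : A * (b ^ 2 + k * b * c + c ^ 2)
          ≤ A * ((B * v) ^ 2 + k * (B * v) * (C * v) + (C * v) ^ 2) := by gcongr
      calc a' * u ≤ A * (a * a') := by linarith
        _ ≤ A * ((B * v) ^ 2 + k * (B * v) * (C * v) + (C * v) ^ 2) := by rw [h']; exact s3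
        _ = A * (B ^ 2 + k * B * C + C ^ 2) * v ^ 2 := by ring
        _ = _ := by rw [← hexp]; ring
    have e2 : a' ≤ A * (B ^ 2 + k * B * C + C ^ 2) * z := le_of_mul_le_mul_right e1 hu
    have : 0 ≤ A * B ^ 2 * z := by positivity
    linarith [add_mul (A * B ^ 2) (A * (B ^ 2 + k * B * C + C ^ 2)) z]

/-- The new order `2 * min q r - p` has the parity of `p`, so the parities of the initial cluster
persist. -/
theorem Reach.exists_hasOrder {k : Fin 3 → ℕ} {x : Fin 3 → Laurent} (h : Reach k x) (j i : Fin 3) :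
    ∃ n : ℤ, HasOrder j n (x i) ∧ (Odd n ↔ i = j) := by
  induction h generalizing i with
  | init =>
    by_cases hi : i = j
    · subst hi
      exact ⟨1, ⟨1, one_pos, fun t _ _ => by simp [evalAt_X_self]⟩, by simp⟩
    · exact ⟨0, ⟨1, one_pos, fun t _ _ => by simp [evalAt_X_of_ne hi]⟩, by simp [hi]⟩
  | @step m x hx ih =>
    by_cases hi : i = m
    · subst hi
      obtain ⟨p, hp, hpj⟩ := ih i
      obtain ⟨q, hq, -⟩ := ih (i + 1)
      obtain ⟨r, hr, -⟩ := ih (i + 2)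
      refine ⟨_, hp.mutation hq hr (hx.isMarkov.mul_vieta i), ?_⟩
      rw [← hpj]
      rw [Int.odd_sub, ← Int.not_even_iff_odd, ← Int.not_even_iff_odd]
      have : Even (2 * min q r) := even_two_mul _
      tauto
    · rw [vieta_of_ne k hi]; exact ih i

theorem Reach.position_unique {k : Fin 3 → ℕ} {x y : Fin 3 → Laurent} (hx : Reach k x)
    (hy : Reach k y) {i j : Fin 3} (h : x i = y j) : i = j := by
  obtain ⟨n, hn, hi⟩ := hx.exists_hasOrder j i
  obtain ⟨n', hn', hj⟩ := hy.exists_hasOrder j j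
  rw [h] at hn
  obtain rfl : n = n' := le_antisymm (hn'.le hn) (hn.le hn')
  exact hi.1 (hj.2 rfl)

theorem IsClusterVariableAt.exists_reach {k : Fin 3 → ℕ} {i : Fin 3} {a : Laurent}
    (h : IsClusterVariableAt k i a) : ∃ x, Reach k x ∧ x i = a := by
  obtain ⟨s, hs, ha⟩ := h
  obtain ⟨x, hx, hsx, -⟩ := hs.exists_reach
  exact ⟨x, hx, IsFractionRing.injective Laurent RatFun (by rw [← hsx, ha])⟩

theorem IsClusterVariableAt.parity_eq {k : Fin 3 → ℕ} {i : Fin 3} {a : Laurent}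
    (h : IsClusterVariableAt k i a) : parity k a = k i := by
  have hex : ∃ i, IsClusterVariableAt k i a := ⟨i, h⟩
  rw [parity, dif_pos hex]
  obtain ⟨x, hx, hxa⟩ := h.exists_reach
  obtain ⟨y, hy, hya⟩ := hex.choose_spec.exists_reach
  rw [hx.position_unique hy (hxa.trans hya.symm)]

/-! ### Labeled triples -/

/-- The matrix with rows `(1, 0)` and `(ℳ, 1)`, of which the matrices `S_P` are multiples. -/
noncomputable def lowerUnip (k : Fin 3 → ℕ) : Mat := !![1, 0; markovInvariant k, 1]

theorem S_eq_smul {k : Fin 3 → ℕ} {P : Mat} {t : Laurent}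
    (h : P.trace = markovInvariant k * P 0 1 - t) : S k P = t • lowerUnip k := by
  rw [S, h, lowerUnip]
  ext i j : 1
  fin_cases i <;> fin_cases j <;> simp

/-- If `A` has determinant `1` and trace `ℳ a₁₂ + t`, subtracting `t • lowerUnip k` keeps the
determinant `1` and turns the trace into `ℳ a₁₂ - t`. This is the role of the matrices `S_P`. -/
theorem det_sub_smul_lowerUnip (k : Fin 3 → ℕ) (A : Mat) (t : Laurent) :
    (A - t • lowerUnip k).det = A.det - t * (A.trace - markovInvariant k * A 0 1) + t ^ 2 := by
  simp [Matrix.det_fin_two, Matrix.trace_fin_two, lowerUnip]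
  ring

theorem trace_sub_smul_lowerUnip (k : Fin 3 → ℕ) (A : Mat) (t : Laurent) :
    (A - t • lowerUnip k).trace = A.trace - 2 * t := by
  simp [Matrix.trace_fin_two, lowerUnip]
  ring

theorem sub_smul_lowerUnip_apply (k : Fin 3 → ℕ) (A : Mat) (t : Laurent) :
    (A - t • lowerUnip k) 0 1 = A 0 1 := by
  simp [lowerUnip]

theorem trace_mul_lowerUnip (k : Fin 3 → ℕ) (A : Mat) :
    (A * lowerUnip k).trace = A.trace + markovInvariant k * A 0 1 := by
  simp [Matrix.trace_fin_two, lowerUnip, Matrix.mul_apply, Fin.sum_univ_two]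
  ring

theorem mul_lowerUnip_apply (k : Fin 3 → ℕ) (A : Mat) : (A * lowerUnip k) 0 1 = A 0 1 := by
  simp [lowerUnip, Matrix.mul_apply, Fin.sum_univ_two]

theorem lowerUnip_mul_apply (k : Fin 3 → ℕ) (A : Mat) : (lowerUnip k * A) 0 1 = A 0 1 := by
  simp [lowerUnip, Matrix.mul_apply, Fin.sum_univ_two]

theorem mul_self_of_det_one {A : Mat} (h : A.det = 1) : A * A = A.trace • A - 1 := by
  rw [Matrix.det_fin_two] at h
  ext i j : 1
  fin_cases i <;> fin_cases j <;>
    simp [Matrix.trace_fin_two, Matrix.mul_apply, Fin.sum_univ_two]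
  · linear_combination -h
  · ring
  · ring
  · linear_combination -h

theorem adjugate_eq_of_det_one (A : Mat) : A.adjugate = A.trace • 1 - A := by
  ext i j : 1
  fin_cases i <;> fin_cases j <;> simp [Matrix.trace_fin_two, Matrix.adjugate_fin_two]

/-- A unimodular matrix is determined by its first row and its trace. -/
theorem ext_of_det_one {A B : Mat} (hA : A.det = 1) (hB : B.det = 1)
    (htr : A.trace = B.trace) (h00 : A 0 0 = B 0 0) (h01 : A 0 1 = B 0 1) (h0 : A 0 1 ≠ 0) :
    A = B := by
  rw [Matrix.trace_fin_two, Matrix.trace_fin_two, h00] at htr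
  have h11 := add_left_cancel htr
  rw [Matrix.det_fin_two] at hA hB
  have h10 : A 1 0 = B 1 0 := by
    apply mul_left_cancel₀ h0
    rw [h00, h11] at hA
    linear_combination hB - hA - B 1 0 * h01
  ext i j : 1
  fin_cases i <;> fin_cases j <;> assumption

/-- `(P, Q, R)` is a triple of unimodular matrices whose `(1,2)`-entries are the entries of `x` in
the positions `τ 0`, `τ 1`, `τ 2`, which satisfy the trace conditions for the parities of these
positions, and such that `Q = P R - S_Q`. -/
structure IsLabeledTriple (k : Fin 3 → ℕ) (τ : Equiv.Perm (Fin 3)) (x : Fin 3 → Laurent)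
    (P Q R : Mat) : Prop where
  detP : P.det = 1
  detQ : Q.det = 1
  detR : R.det = 1
  trP : P.trace = markovInvariant k * P 0 1 - k (τ 0)
  trQ : Q.trace = markovInvariant k * Q 0 1 - k (τ 1)
  trR : R.trace = markovInvariant k * R 0 1 - k (τ 2)
  entryP : P 0 1 = x (τ 0)
  entryQ : Q 0 1 = x (τ 1)
  entryR : R 0 1 = x (τ 2)
  relation : Q = P * R - S k Q

theorem perm_fin3_cases (τ : Equiv.Perm (Fin 3)) (i j l : Fin 3) (h : i ≠ j ∧ j ≠ l ∧ i ≠ l) :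
    (τ i = τ j + 1 ∧ τ l = τ j + 2) ∨ (τ i = τ j + 2 ∧ τ l = τ j + 1) := by
  have h1 : τ i ≠ τ j := by simp [h.1]
  have h2 : τ j ≠ τ l := by simp [h.2.1]
  have h3 : τ i ≠ τ l := by simp [h.2.2]
  generalize τ i = a at *
  generalize τ j = b at *
  generalize τ l = c at *
  clear h
  revert a b c
  decide

theorem vieta_perm (k : Fin 3 → ℕ) (x : Fin 3 → Laurent) (τ : Equiv.Perm (Fin 3)) (i j l : Fin 3)
    (h : i ≠ j ∧ j ≠ l ∧ i ≠ l) : vieta k (τ j) x (τ j)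
      = markovInvariant k * x (τ i) * x (τ l) - k (τ i) * x (τ l) - k (τ l) * x (τ i)
        - x (τ j) := by
  rw [vieta_self]
  rcases perm_fin3_cases τ i j l h with ⟨h1, h2⟩ | ⟨h1, h2⟩ <;> rw [h1, h2]
  ring

namespace IsLabeledTriple

variable {k : Fin 3 → ℕ} {τ : Equiv.Perm (Fin 3)} {x : Fin 3 → Laurent} {P Q R : Mat}

theorem mul_eq (h : IsLabeledTriple k τ x P Q R) :
    P * R = Q + (k (τ 1) : Laurent) • lowerUnip k := by
  rw [← S_eq_smul h.trQ]
  exact (sub_eq_iff_eq_add.1 h.relation.symm)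

/-- Substituting for `Q` and applying Cayley–Hamilton to `P * P` makes `P * Q` linear in `Q`, `R`
and `P * lowerUnip k`, so its trace and `(1,2)`-entry can be read off. -/
theorem left_mul_middle (h : IsLabeledTriple k τ x P Q R) :
    P * Q = P.trace • (Q + (k (τ 1) : Laurent) • lowerUnip k) - R
      - (k (τ 1) : Laurent) • (P * lowerUnip k) := by
  have hQ : Q = P * R - (k (τ 1) : Laurent) • lowerUnip k := by rw [h.mul_eq]; abel
  calc P * Q = (P * P) * R - (k (τ 1) : Laurent) • (P * lowerUnip k) := by
        conv_lhs => rw [hQ, mul_sub, Matrix.mul_smul, ← mul_assoc]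
    _ = _ := by rw [mul_self_of_det_one h.detP, sub_mul, Matrix.smul_mul, h.mul_eq, one_mul]

theorem middle_mul_right (h : IsLabeledTriple k τ x P Q R) :
    Q * R = R.trace • (Q + (k (τ 1) : Laurent) • lowerUnip k) - P
      - (k (τ 1) : Laurent) • (lowerUnip k * R) := by
  have hQ : Q = P * R - (k (τ 1) : Laurent) • lowerUnip k := by rw [h.mul_eq]; abel
  calc Q * R = P * (R * R) - (k (τ 1) : Laurent) • (lowerUnip k * R) := by
        conv_lhs => rw [hQ, sub_mul, Matrix.smul_mul, mul_assoc]
    _ = _ := by rw [mul_self_of_det_one h.detR, mul_sub, Matrix.mul_smul, h.mul_eq, mul_one]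

end IsLabeledTriple

theorem trace_lowerUnip (k : Fin 3 → ℕ) : (lowerUnip k).trace = 2 := by
  simp [lowerUnip, Matrix.trace_fin_two]; norm_num

theorem lowerUnip_apply (k : Fin 3 → ℕ) : lowerUnip k 0 1 = 0 := by simp [lowerUnip]

theorem trace_lowerUnip_mul (k : Fin 3 → ℕ) (A : Mat) :
    (lowerUnip k * A).trace = A.trace + markovInvariant k * A 0 1 := by
  rw [Matrix.trace_mul_comm, trace_mul_lowerUnip]

/-! ### Children and parents of labeled triples -/

namespace IsLabeledTriple

variable {k : Fin 3 → ℕ} {τ : Equiv.Perm (Fin 3)} {x : Fin 3 → Laurent} {P Q R : Mat}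

theorem leftChild (h : IsLabeledTriple k τ x P Q R) :
    IsLabeledTriple k (τ * Equiv.swap 1 2) (vieta k (τ 2) x) P (P * Q - S k R) Q := by
  have e0 : (τ * Equiv.swap 1 2 : Equiv.Perm (Fin 3)) 0 = τ 0 := by
    simp [Equiv.swap_apply_of_ne_of_ne]
  have e1 : (τ * Equiv.swap 1 2 : Equiv.Perm (Fin 3)) 1 = τ 2 := by simp
  have e2 : (τ * Equiv.swap 1 2 : Equiv.Perm (Fin 3)) 2 = τ 1 := by simp
  have hS := S_eq_smul h.trR
  have entry : (P * Q - S k R) 0 1 = vieta k (τ 2) x (τ 2) := by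
    rw [hS, sub_smul_lowerUnip_apply, h.left_mul_middle, vieta_perm k x τ 0 2 1 (by decide)]
    simp only [Matrix.sub_apply, Matrix.add_apply, Matrix.smul_apply, smul_eq_mul,
      mul_lowerUnip_apply, lowerUnip_apply, h.trP, h.entryP, h.entryQ, h.entryR]
    ring
  have hPQ : (P * Q).trace = markovInvariant k * (P * Q) 0 1 + k (τ 2) := by
    rw [h.left_mul_middle]
    simp only [Matrix.trace_sub, Matrix.trace_add, Matrix.trace_smul, trace_mul_lowerUnip,
      trace_lowerUnip, Matrix.sub_apply, Matrix.add_apply, Matrix.smul_apply, smul_eq_mul,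
      mul_lowerUnip_apply, lowerUnip_apply, h.trP, h.trQ, h.trR]
    ring
  have tr : (P * Q - S k R).trace = markovInvariant k * (P * Q - S k R) 0 1 - k (τ 2) := by
    rw [hS, trace_sub_smul_lowerUnip, sub_smul_lowerUnip_apply, hPQ]
    ring
  refine ⟨h.detP, ?_, h.detQ, ?_, ?_, ?_, ?_, ?_, ?_, ?_⟩
  · rw [hS, det_sub_smul_lowerUnip, Matrix.det_mul, h.detP, h.detQ, hPQ]
    ring
  · rw [e0, h.trP]
  · rw [e1, tr]
  · rw [e2, h.trQ]
  · rw [e0, vieta_of_ne k (by simp), h.entryP]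
  · rw [e1, entry]
  · rw [e2, vieta_of_ne k (by simp), h.entryQ]
  · rw [S_eq_smul tr, hS]

theorem rightChild (h : IsLabeledTriple k τ x P Q R) :
    IsLabeledTriple k (τ * Equiv.swap 0 1) (vieta k (τ 0) x) Q (Q * R - S k P) R := by
  have e0 : (τ * Equiv.swap 0 1 : Equiv.Perm (Fin 3)) 0 = τ 1 := by simp
  have e1 : (τ * Equiv.swap 0 1 : Equiv.Perm (Fin 3)) 1 = τ 0 := by simp
  have e2 : (τ * Equiv.swap 0 1 : Equiv.Perm (Fin 3)) 2 = τ 2 := by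
    simp [Equiv.swap_apply_of_ne_of_ne]
  have hS := S_eq_smul h.trP
  have entry : (Q * R - S k P) 0 1 = vieta k (τ 0) x (τ 0) := by
    rw [hS, sub_smul_lowerUnip_apply, h.middle_mul_right, vieta_perm k x τ 1 0 2 (by decide)]
    simp only [Matrix.sub_apply, Matrix.add_apply, Matrix.smul_apply, smul_eq_mul,
      lowerUnip_mul_apply, lowerUnip_apply, h.trR, h.entryP, h.entryQ, h.entryR]
    ring
  have hQR : (Q * R).trace = markovInvariant k * (Q * R) 0 1 + k (τ 0) := by
    rw [h.middle_mul_right]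
    simp only [Matrix.trace_sub, Matrix.trace_add, Matrix.trace_smul, trace_lowerUnip_mul,
      trace_lowerUnip, Matrix.sub_apply, Matrix.add_apply, Matrix.smul_apply, smul_eq_mul,
      lowerUnip_mul_apply, lowerUnip_apply, h.trP, h.trQ, h.trR]
    ring
  have tr : (Q * R - S k P).trace = markovInvariant k * (Q * R - S k P) 0 1 - k (τ 0) := by
    rw [hS, trace_sub_smul_lowerUnip, sub_smul_lowerUnip_apply, hQR]
    ring
  refine ⟨h.detQ, ?_, h.detR, ?_, ?_, ?_, ?_, ?_, ?_, ?_⟩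
  · rw [hS, det_sub_smul_lowerUnip, Matrix.det_mul, h.detQ, h.detR, hQR]
    ring
  · rw [e0, h.trQ]
  · rw [e1, tr]
  · rw [e2, h.trR]
  · rw [e0, vieta_of_ne k (by simp), h.entryQ]
  · rw [e1, entry]
  · rw [e2, vieta_of_ne k (by simp), h.entryR]
  · rw [S_eq_smul tr, hS]

/-- Every labeled triple is a left child of a labeled triple. -/
theorem exists_leftChild (h : IsLabeledTriple k τ x P Q R) :
    ∃ R', IsLabeledTriple k (τ * Equiv.swap 1 2) (vieta k (τ 1) x) P R R' ∧
      GenMarkov.leftChild k (P, R, R') = (P, Q, R) := by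
  have e0 : (τ * Equiv.swap 1 2 : Equiv.Perm (Fin 3)) 0 = τ 0 := by
    simp [Equiv.swap_apply_of_ne_of_ne]
  have e1 : (τ * Equiv.swap 1 2 : Equiv.Perm (Fin 3)) 1 = τ 2 := by simp
  have e2 : (τ * Equiv.swap 1 2 : Equiv.Perm (Fin 3)) 2 = τ 1 := by simp
  set N := lowerUnip k with hN
  -- Forced by the relation `R = P R' - S_R` of the parent, since the adjugate is the inverse of
  -- `P`.
  set R' := P.adjugate * (R + (k (τ 2) : Laurent) • N) with hR'
  have hexp : R' = P.trace • R - Q - (k (τ 1) : Laurent) • N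
      + (P.trace * k (τ 2)) • N - (k (τ 2) : Laurent) • (P * N) := by
    rw [hR', adjugate_eq_of_det_one, sub_mul, Matrix.smul_mul, one_mul, mul_add, h.mul_eq,
      Matrix.mul_smul, smul_add, smul_smul, ← hN]
    abel
  have hPR' : P * R' = R + (k (τ 2) : Laurent) • N := by
    rw [hR', ← mul_assoc, Matrix.mul_adjugate, h.detP, one_smul, one_mul]
  have entry : R' 0 1 = vieta k (τ 1) x (τ 1) := by
    rw [hexp, vieta_perm k x τ 0 1 2 (by decide)]
    simp only [Matrix.sub_apply, Matrix.add_apply, Matrix.smul_apply, smul_eq_mul, hN,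
      mul_lowerUnip_apply, lowerUnip_apply, h.trP, h.entryP, h.entryQ, h.entryR]
    ring
  have tr : R'.trace = markovInvariant k * R' 0 1 - k (τ 1) := by
    rw [hexp]
    simp only [Matrix.trace_sub, Matrix.trace_add, Matrix.trace_smul, trace_mul_lowerUnip,
      trace_lowerUnip, Matrix.sub_apply, Matrix.add_apply, Matrix.smul_apply, smul_eq_mul, hN,
      mul_lowerUnip_apply, lowerUnip_apply, h.trP, h.trQ, h.trR]
    ring
  have det : R'.det = 1 := by
    have h1 : R + (k (τ 2) : Laurent) • N = R - (-(k (τ 2) : Laurent)) • N := by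
      rw [neg_smul, sub_neg_eq_add]
    have h2 := congrArg Matrix.det hPR'
    rw [Matrix.det_mul, h.detP, one_mul, h1, hN, det_sub_smul_lowerUnip, h.detR, h.trR] at h2
    rw [h2]
    ring
  refine ⟨R', ⟨h.detP, h.detR, det, ?_, ?_, ?_, ?_, ?_, ?_, ?_⟩, ?_⟩
  · rw [e0, h.trP]
  · rw [e1, h.trR]
  · rw [e2, tr]
  · rw [e0, vieta_of_ne k (by simp), h.entryP]
  · rw [e1, vieta_of_ne k (by simp), h.entryR]
  · rw [e2, entry]
  · rw [S_eq_smul h.trR, hPR', ← hN]; abel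
  · simp only [GenMarkov.leftChild]
    rw [S_eq_smul tr, h.mul_eq, add_sub_cancel_right]

/-- Every labeled triple is a right child of a labeled triple. -/
theorem exists_rightChild (h : IsLabeledTriple k τ x P Q R) :
    ∃ P', IsLabeledTriple k (τ * Equiv.swap 0 1) (vieta k (τ 1) x) P' P R ∧
      GenMarkov.rightChild k (P', P, R) = (P, Q, R) := by
  have e0 : (τ * Equiv.swap 0 1 : Equiv.Perm (Fin 3)) 0 = τ 1 := by simp
  have e1 : (τ * Equiv.swap 0 1 : Equiv.Perm (Fin 3)) 1 = τ 0 := by simp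
  have e2 : (τ * Equiv.swap 0 1 : Equiv.Perm (Fin 3)) 2 = τ 2 := by
    simp [Equiv.swap_apply_of_ne_of_ne]
  set N := lowerUnip k with hN
  -- Forced by `P = P' R - S_P`.
  set P' := (P + (k (τ 0) : Laurent) • N) * R.adjugate with hP'
  have hexp : P' = R.trace • P - Q - (k (τ 1) : Laurent) • N
      + (R.trace * k (τ 0)) • N - (k (τ 0) : Laurent) • (N * R) := by
    rw [hP', adjugate_eq_of_det_one, mul_sub, Matrix.mul_smul, mul_one, add_mul, h.mul_eq,
      Matrix.smul_mul, smul_add, smul_smul, ← hN]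
    abel
  have hP'R : P' * R = P + (k (τ 0) : Laurent) • N := by
    rw [hP', mul_assoc, Matrix.adjugate_mul, h.detR, one_smul, mul_one]
  have entry : P' 0 1 = vieta k (τ 1) x (τ 1) := by
    rw [hexp, vieta_perm k x τ 0 1 2 (by decide)]
    simp only [Matrix.sub_apply, Matrix.add_apply, Matrix.smul_apply, smul_eq_mul, hN,
      lowerUnip_mul_apply, lowerUnip_apply, h.trR, h.entryP, h.entryQ, h.entryR]
    ring
  have tr : P'.trace = markovInvariant k * P' 0 1 - k (τ 1) := by
    rw [hexp]
    simp only [Matrix.trace_sub, Matrix.trace_add, Matrix.trace_smul, trace_lowerUnip_mul,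
      trace_lowerUnip, Matrix.sub_apply, Matrix.add_apply, Matrix.smul_apply, smul_eq_mul, hN,
      lowerUnip_mul_apply, lowerUnip_apply, h.trP, h.trQ, h.trR]
    ring
  have det : P'.det = 1 := by
    have h1 : P + (k (τ 0) : Laurent) • N = P - (-(k (τ 0) : Laurent)) • N := by
      rw [neg_smul, sub_neg_eq_add]
    have h2 := congrArg Matrix.det hP'R
    rw [Matrix.det_mul, h.detR, mul_one, h1, hN, det_sub_smul_lowerUnip, h.detP, h.trP] at h2
    rw [h2]
    ring
  refine ⟨P', ⟨det, h.detP, h.detR, ?_, ?_, ?_, ?_, ?_, ?_, ?_⟩, ?_⟩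
  · rw [e0, tr]
  · rw [e1, h.trP]
  · rw [e2, h.trR]
  · rw [e0, entry]
  · rw [e1, vieta_of_ne k (by simp), h.entryP]
  · rw [e2, vieta_of_ne k (by simp), h.entryR]
  · rw [S_eq_smul h.trP, hP'R, ← hN]; abel
  · simp only [GenMarkov.rightChild]
    rw [S_eq_smul tr, h.mul_eq, add_sub_cancel_right]

/-! ### Data that determine a labeled triple -/

theorem right_unique {P' Q' R' : Mat} (h : IsLabeledTriple k τ x P Q R) {τ' : Equiv.Perm (Fin 3)}
    {x' : Fin 3 → Laurent} (h' : IsLabeledTriple k τ' x' P' Q' R') (hP : P = P') (hQ : Q = Q') :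
    R = R' := by
  subst hP hQ
  have h1 : P * R = P * R' := by
    rw [← sub_left_inj, ← h.relation, ← h'.relation]
  have h2 := congrArg (P.adjugate * ·) h1
  simpa only [← mul_assoc, Matrix.adjugate_mul, h.detP, one_smul, one_mul] using h2

theorem left_unique {P' Q' R' : Mat} (h : IsLabeledTriple k τ x P Q R) {τ' : Equiv.Perm (Fin 3)}
    {x' : Fin 3 → Laurent} (h' : IsLabeledTriple k τ' x' P' Q' R') (hQ : Q = Q') (hR : R = R') :
    P = P' := by
  subst hQ hR
  have h1 : P * R = P' * R := by
    rw [← sub_left_inj, ← h.relation, ← h'.relation]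
  have h2 := congrArg (· * R.adjugate) h1
  simpa only [mul_assoc, Matrix.mul_adjugate, h.detR, one_smul, mul_one] using h2

theorem ext_of_entry {P' Q' R' : Mat} (h : IsLabeledTriple k τ x P Q R)
    (h' : IsLabeledTriple k τ x P' Q' R') (hx : ∀ i, x i ≠ 0) (h00 : P 0 0 = P' 0 0) :
    (P, Q, R) = (P', Q', R') := by
  obtain rfl : P = P' := ext_of_det_one h.detP h'.detP
    (by rw [h.trP, h'.trP, h.entryP, h'.entryP]) h00 (by rw [h.entryP, h'.entryP])
    (by rw [h.entryP]; exact hx _)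
  -- The `(1,2)`-entry of the relation, to which `S_Q` does not contribute; it determines `R 1 1`,
  -- and the trace then gives `R 0 0`.
  have key : ∀ {Q R}, IsLabeledTriple k τ x P Q R →
      P 0 0 * x (τ 2) + x (τ 0) * R 1 1 = x (τ 1) := by
    intro Q R h
    have e := congrFun (congrFun h.mul_eq 0) 1
    rw [Matrix.mul_apply, Fin.sum_univ_two, Matrix.add_apply, Matrix.smul_apply, lowerUnip_apply,
      h.entryP, h.entryQ, h.entryR, smul_zero, add_zero] at e
    exact e
  have h11 : R 1 1 = R' 1 1 := by
    apply mul_left_cancel₀ (hx (τ 0))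
    linear_combination key h - key h'
  have htr : R.trace = R'.trace := by rw [h.trR, h'.trR, h.entryR, h'.entryR]
  obtain rfl : R = R' := ext_of_det_one h.detR h'.detR htr
    (by rw [Matrix.trace_fin_two, Matrix.trace_fin_two, h11] at htr; exact add_right_cancel htr)
    (by rw [h.entryR, h'.entryR]) (by rw [h.entryR]; exact hx _)
  have e := h.mul_eq.symm.trans h'.mul_eq
  rw [add_right_cancel e]

end IsLabeledTriple

/-! ### The root -/

theorem markovInvariant_perm (k : Fin 3 → ℕ) (ρ : Equiv.Perm (Fin 3)) :
    markovInvariant k = (X (ρ 0) ^ 2 + X (ρ 1) ^ 2 + X (ρ 2) ^ 2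
      + (k (ρ 0) : Laurent) * X (ρ 1) * X (ρ 2) + (k (ρ 1) : Laurent) * X (ρ 0) * X (ρ 2)
      + (k (ρ 2) : Laurent) * X (ρ 0) * X (ρ 1)) * (Xinv (ρ 0) * Xinv (ρ 1) * Xinv (ρ 2)) := by
  rw [markovInvariant]
  have h01 : ρ 0 ≠ ρ 1 := by simp
  have h02 : ρ 0 ≠ ρ 2 := by simp
  have h12 : ρ 1 ≠ ρ 2 := by simp
  generalize ρ 0 = a at *
  generalize ρ 1 = b at *
  generalize ρ 2 = c at *
  fin_cases a <;> fin_cases b <;> fin_cases c <;> simp at h01 h02 h12 <;>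
    simp only [Fin.mk_one, Fin.zero_eta, Fin.reduceFinMk] <;> ring

theorem unimod_det (i : Fin 3) (p q : Laurent) : (unimod i p q).det = 1 := by
  simp only [unimod, Matrix.det_fin_two_of]
  linear_combination (1 - p * q) * X_mul_Xinv i

theorem unimod_trace (i : Fin 3) (p q : Laurent) : (unimod i p q).trace = p + q := by
  simp [unimod, Matrix.trace_fin_two]

theorem unimod_apply (i : Fin 3) (p q : Laurent) : unimod i p q 0 1 = X i := by
  simp [unimod]

theorem isLabeledTriple_PQR (k : Fin 3 → ℕ) (ρ : Equiv.Perm (Fin 3)) (f : Laurent) :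
    IsLabeledTriple k ρ X (Pmat k ρ f) (Qmat k ρ f) (Rmat k ρ f) := by
  have h0 := X_mul_Xinv (ρ 0)
  have h1 := X_mul_Xinv (ρ 1)
  have h2 := X_mul_Xinv (ρ 2)
  have hM := markovInvariant_perm k ρ
  have trQ : (Qmat k ρ f).trace = markovInvariant k * Qmat k ρ f 0 1 - k (ρ 1) := by
    rw [hM, Qmat, unimod_trace, unimod_apply]
    generalize X (ρ 0) = a at *
    generalize X (ρ 1) = b at *
    generalize X (ρ 2) = c at *
    grind
  refine ⟨unimod_det .., unimod_det .., unimod_det .., ?_, trQ, ?_, unimod_apply ..,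
    unimod_apply .., unimod_apply .., ?_⟩
  · rw [hM, Pmat, unimod_trace, unimod_apply]
    generalize X (ρ 0) = a at *
    generalize X (ρ 1) = b at *
    generalize X (ρ 2) = c at *
    grind
  · rw [hM, Rmat, unimod_trace, unimod_apply]
    generalize X (ρ 0) = a at *
    generalize X (ρ 1) = b at *
    generalize X (ρ 2) = c at *
    grind
  · rw [S_eq_smul trQ, lowerUnip, hM]
    simp only [Pmat, Qmat, Rmat, unimod]
    clear hM trQ
    generalize Xinv (ρ 0) = a' at *
    generalize Xinv (ρ 1) = b' at *
    generalize Xinv (ρ 2) = c' at *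
    generalize X (ρ 0) = a at *
    generalize X (ρ 1) = b at *
    generalize X (ρ 2) = c at *
    ext i j : 1
    fin_cases i <;> fin_cases j <;> simp
    all_goals grind

/-- The root is the left child of `(P_ρ, Q_ρ, R_ρ)`, which lies over the initial cluster; the swap
in `ρ` cancels the one made by `leftChild`. -/
theorem isLabeledTriple_cgcRoot (k : Fin 3 → ℕ) (σ : Equiv.Perm (Fin 3)) (f : Laurent) :
    IsLabeledTriple k σ (vieta k (σ 1) X) (cgcRoot k σ f).1 (cgcRoot k σ f).2.1
      (cgcRoot k σ f).2.2 := by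
  have h := (isLabeledTriple_PQR k (σ * Equiv.swap 1 2) f).leftChild
  rw [mul_assoc, Equiv.swap_mul_self, mul_one] at h
  simp only [Equiv.Perm.mul_apply, Equiv.swap_apply_right] at h
  exact h

/-! ### The tree -/

theorem exists_isLabeledTriple_cgcTree (k : Fin 3 → ℕ) (σ : Equiv.Perm (Fin 3)) (f : Laurent)
    (w : List Bool) : ∃ τ x, Red k (τ 1) x ∧ IsLabeledTriple k τ x (cgcTree k σ f w).1
      (cgcTree k σ f w).2.1 (cgcTree k σ f w).2.2 := by
  induction w with
  | nil => exact ⟨σ, _, .init _, isLabeledTriple_cgcRoot k σ f⟩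
  | cons c w ih =>
    obtain ⟨τ, x, hx, h⟩ := ih
    cases c with
    | false =>
      refine ⟨τ * Equiv.swap 1 2, vieta k (τ 2) x, ?_, h.leftChild⟩
      simpa using hx.step (τ 2) (by simp)
    | true =>
      refine ⟨τ * Equiv.swap 0 1, vieta k (τ 0) x, ?_, h.rightChild⟩
      simpa using hx.step (τ 0) (by simp)

theorem cgcTree_lt (k : Fin 3 → ℕ) (σ : Equiv.Perm (Fin 3)) (f : Laurent) (w : List Bool) :
    1 ≤ evalOne ((cgcTree k σ f w).1 0 1) ∧ 1 ≤ evalOne ((cgcTree k σ f w).2.2 0 1) ∧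
    evalOne ((cgcTree k σ f w).1 0 1) < evalOne ((cgcTree k σ f w).2.1 0 1) ∧
    evalOne ((cgcTree k σ f w).2.2 0 1) < evalOne ((cgcTree k σ f w).2.1 0 1) := by
  obtain ⟨τ, x, hx, h⟩ := exists_isLabeledTriple_cgcTree k σ f w
  rw [h.entryP, h.entryQ, h.entryR]
  exact ⟨hx.one_le_evalOne _, hx.one_le_evalOne _, hx.evalOne_lt (by simp),
    hx.evalOne_lt (by simp)⟩

theorem cgcRoot_left_apply (k : Fin 3 → ℕ) (σ : Equiv.Perm (Fin 3)) (f : Laurent) :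
    (cgcRoot k σ f).1 0 1 = X (σ 0) := by
  simp [cgcRoot, Pmat, unimod, Equiv.swap_apply_of_ne_of_ne]

theorem cgcRoot_right_apply (k : Fin 3 → ℕ) (σ : Equiv.Perm (Fin 3)) (f : Laurent) :
    (cgcRoot k σ f).2.2 0 1 = X (σ 2) := by
  simp [cgcRoot, Qmat, unimod]

theorem cgcRoot_left_apply_zero (k : Fin 3 → ℕ) (σ : Equiv.Perm (Fin 3)) (f : Laurent) :
    (cgcRoot k σ f).1 0 0 = f := by
  simp [cgcRoot, Pmat, unimod]

theorem X_injective : Function.Injective X := by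
  intro i j h
  exact (Reach.init (k := 0)).position_unique .init h

theorem cgcRoot_injective {k : Fin 3 → ℕ} {σ σ' : Equiv.Perm (Fin 3)} {f f' : Laurent}
    (h : cgcRoot k σ f = cgcRoot k σ' f') : σ = σ' ∧ f = f' := by
  have h0 := congrArg (fun T => T.1 0 1) h
  have h2 := congrArg (fun T => T.2.2 0 1) h
  have hf := congrArg (fun T => T.1 0 0) h
  simp only [cgcRoot_left_apply, cgcRoot_right_apply, cgcRoot_left_apply_zero] at h0 h2 hf
  refine ⟨?_, hf⟩
  have e0 := X_injective h0
  have e2 := X_injective h2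
  revert e0 e2
  clear h h0 h2 hf
  revert σ σ'
  decide

/-- The outer `(1,2)`-entries of a vertex other than the root tell whether it is a left or a right
child. -/
theorem cgcTree_cons_lt (k : Fin 3 → ℕ) (σ : Equiv.Perm (Fin 3)) (f : Laurent) (c : Bool)
    (w : List Bool) : if c then
      evalOne ((cgcTree k σ f (c :: w)).2.2 0 1) < evalOne ((cgcTree k σ f (c :: w)).1 0 1)
    else evalOne ((cgcTree k σ f (c :: w)).1 0 1) < evalOne ((cgcTree k σ f (c :: w)).2.2 0 1) := by
  have h := cgcTree_lt k σ f w
  cases c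
  · exact h.2.2.1
  · exact h.2.2.2

theorem cgcTree_injective {k : Fin 3 → ℕ} {σ σ' : Equiv.Perm (Fin 3)} {f f' : Laurent}
    {w w' : List Bool} (h : cgcTree k σ f w = cgcTree k σ' f' w') : σ = σ' ∧ f = f' ∧ w = w' := by
  -- The outer entries of a root are initial variables, both of value `1`, whereas those of any
  -- other vertex have distinct values.
  have root_ne : ∀ (σ σ' : Equiv.Perm (Fin 3)) (f f' : Laurent) (c : Bool) (w : List Bool),
      cgcRoot k σ f ≠ cgcTree k σ' f' (c :: w) := by
    intro σ σ' f f' c w h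
    have h1 := cgcTree_cons_lt k σ' f' c w
    rw [← h, cgcRoot_left_apply, cgcRoot_right_apply, evalOne_X, evalOne_X] at h1
    simp at h1
  induction w generalizing w' with
  | nil =>
    cases w' with
    | nil => exact ⟨(cgcRoot_injective h).1, (cgcRoot_injective h).2, rfl⟩
    | cons c w' => exact (root_ne _ _ _ _ _ _ h).elim
  | cons c w ih =>
    cases w' with
    | nil => exact (root_ne _ _ _ _ _ _ h.symm).elim
    | cons c' w' =>
      have h1 := cgcTree_cons_lt k σ f c w
      have h2 := cgcTree_cons_lt k σ' f' c' w'
      rw [h] at h1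
      obtain ⟨τ, x, -, t⟩ := exists_isLabeledTriple_cgcTree k σ f w
      obtain ⟨τ', x', -, t'⟩ := exists_isLabeledTriple_cgcTree k σ' f' w'
      have hP := congrArg (fun T => T.1) h
      have hR := congrArg (fun T => T.2.2) h
      cases c <;> cases c' <;> simp only [if_true, Bool.false_eq_true, if_false] at h1 h2
      · obtain ⟨e1, e2, e3⟩ := ih (w' := w')
          (Prod.ext hP (Prod.ext hR (t.right_unique t' hP hR)))
        exact ⟨e1, e2, by rw [e3]⟩
      · exact absurd h1 h2.not_gt
      · exact absurd h1 h2.not_gt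
      · obtain ⟨e1, e2, e3⟩ := ih (w' := w')
          (Prod.ext (t.left_unique t' hP hR) (Prod.ext hP hR))
        exact ⟨e1, e2, by rw [e3]⟩

theorem fin3_eq_or_eq {i : Fin 3} (h : i ≠ 1) : i = 0 ∨ i = 2 := by
  revert i; decide

theorem Red.exists_cgcTree {k : Fin 3 → ℕ} {m : Fin 3} {x : Fin 3 → Laurent} (hx : Red k m x)
    {τ : Equiv.Perm (Fin 3)} (hτ : τ 1 = m) {P Q R : Mat} (h : IsLabeledTriple k τ x P Q R) :
    ∃ σ f w, cgcTree k σ f w = (P, Q, R) := by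
  induction hx generalizing τ P Q R with
  | init m =>
    subst hτ
    exact ⟨τ, P 0 0, [], (isLabeledTriple_cgcRoot k τ (P 0 0)).ext_of_entry h
      (Reach.init.step (τ 1)).ne_zero (cgcRoot_left_apply_zero ..)⟩
  | @step m j x hj hr ih =>
    subst hτ
    obtain ⟨i, rfl⟩ := τ.surjective m
    have hi : i = 0 ∨ i = 2 := fin3_eq_or_eq fun e => hj (by rw [e])
    -- The preceding jump must be in the middle position of the parent. Undoing a right child moves
    -- position `τ 0` to the middle, and undoing a left child moves `τ 2` there.
    rcases hi with rfl | rfl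
    · obtain ⟨P', hP', e⟩ := h.exists_rightChild
      rw [vieta_vieta] at hP'
      obtain ⟨σ, f, w, hw⟩ := ih (by simp) hP'
      exact ⟨σ, f, true :: w, by rw [cgcTree, hw, e]⟩
    · obtain ⟨R', hR', e⟩ := h.exists_leftChild
      rw [vieta_vieta] at hR'
      obtain ⟨σ, f, w, hw⟩ := ih (by simp) hR'
      exact ⟨σ, f, false :: w, by rw [cgcTree, hw, e]⟩

theorem IsCGCTriple.exists_isLabeledTriple {k : Fin 3 → ℕ} {P Q R : Mat}
    (h : IsCGCTriple k P Q R) : ∃ τ x, Reach k x ∧ IsLabeledTriple k τ x P Q R := by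
  obtain ⟨s, hs, τ, hP, hQ, hR⟩ := h.isCluster
  obtain ⟨x, hx, hsx, -⟩ := hs.exists_reach
  have hinj : Function.Injective (algebraMap Laurent RatFun) := IsFractionRing.injective _ _
  have parity_cast : ∀ {i : Fin 3} {a : Laurent}, s.x i = algebraMap Laurent RatFun a →
      ((parity k a : ℤ) : Laurent) = k i := by
    intro i a ha
    rw [IsClusterVariableAt.parity_eq ⟨s, hs, ha⟩, Int.cast_natCast]
  refine ⟨τ, x, hx, h.left.det_eq, h.middle.det_eq, h.right.det_eq, ?_, ?_, ?_, ?_, ?_, ?_,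
    h.relation⟩
  · rw [h.left.trace_eq, parity_cast hP]
  · rw [h.middle.trace_eq, parity_cast hQ]
  · rw [h.right.trace_eq, parity_cast hR]
  · exact hinj (by rw [← hsx, hP])
  · exact hinj (by rw [← hsx, hQ])
  · exact hinj (by rw [← hsx, hR])

end GenMarkov

theorem mainTheorem4 (k : Fin 3 → ℕ) (P Q R : GenMarkov.Mat) (a b c : GenMarkov.Laurent)
    (hT : GenMarkov.IsCGCTripleAssociated k P Q R a b c)
    (hb : max (GenMarkov.evalOne a) (GenMarkov.evalOne c) < GenMarkov.evalOne b) :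
    ∃! v : GenMarkov.Laurent × Equiv.Perm (Fin 3) × List Bool,
      GenMarkov.cgcTree k v.2.1 v.1 v.2.2 = (P, Q, R) := by
  obtain ⟨τ, x, hx, h⟩ := hT.isTriple.exists_isLabeledTriple
  rw [max_lt_iff, ← hT.left_eq, ← hT.middle_eq, ← hT.right_eq, h.entryP, h.entryQ, h.entryR] at hb
  have hex : ∃ σ f w, GenMarkov.cgcTree k σ f w = (P, Q, R) := by
    rcases hx.eq_or_red with rfl | ⟨m, hm⟩
    · simp [GenMarkov.evalOne_X] at hb
    · refine hm.exists_cgcTree ?_ h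
      obtain ⟨i, rfl⟩ := τ.surjective m
      by_contra hne
      have hlt := hm.evalOne_lt hne
      have hi : i = 0 ∨ i = 2 := GenMarkov.fin3_eq_or_eq fun e => hne (by rw [e])
      rcases hi with rfl | rfl
      · exact absurd hlt hb.1.not_gt
      · exact absurd hlt hb.2.not_gt
  obtain ⟨σ, f, w, hw⟩ := hex
  refine ⟨(f, σ, w), hw, ?_⟩
  rintro ⟨f', σ', w'⟩ hw'
  obtain ⟨rfl, rfl, rfl⟩ := GenMarkov.cgcTree_injective (hw'.trans hw.symm)
  rfl
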